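/- Let $H$ and $K$ be complex Hilbert spaces, let $A, C$ be bounded linear operators on $H$ and let $B, D$ be bounded linear operators on $K$. Suppose that a bilinear form $u : H \times K \to \mathbb{C}$ (complex linear in each argument) satisfies $$|u(x,y)| \le \|Ax\|\,\|By\| + \|Cx\|\,\|Dy\| \qquad \text{for all } x \in H,\ y \in K.$$ Then there are bilinear forms $u_1, u_2 : H \times K \to \mathbb{C}$ with $u = u_1 + u_2$ such that $$|u_1(x,y)| \le \|Ax\|\,\|By\| \quad\text{and}\quad |u_2(x,y)| \le \|Cx\|\,\|Dy\| \qquad \text{for all } x \in H,\ y \in K.$$ -/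

import Mathlib

/-! On ℂⁿ the matrices dominated by ‖Px‖‖Qy‖ form a compact convex set, so by Hahn–Banach it is
enough to find, for each T, dominated V₁, V₂ with Re tr(TU) ≤ Re tr(T(V₁ + V₂)). A perturbation
makes T invertible, and T is then absorbed into the variable y. For T = 1 take V₁ = Q*Q m₁, where m₁
> 0 and m₁ Q*Q m₁ = P*P. Cauchy–Schwarz dominates V₁, with equality when m₁x is a nonnegative
multiple of y; V₂ is built likewise from R, S. Diagonalising m₁ and m₂ simultaneously yields dual
bases on which both equalities hold, and summing the hypothesis over them gives the inequality
(`exists_re_trace_le`). Hilbert spaces follow by restricting to finite-dimensional subspaces, adding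
ε to get invertible matrices, and taking an ultrafilter limit. -/

/-- The Euclidean norm of a complex vector. -/
noncomputable def euclNorm {n : Type*} [Fintype n] (v : n → ℂ) : ℝ := ‖WithLp.toLp 2 v‖

/-! ### Positive definite matrices: geometric mean and simultaneous diagonalization -/

section FiniteDimensional

open Matrix
open scoped ComplexOrder MatrixOrder

variable {n : Type*} [Fintype n]

theorem euclNorm_nonneg (v : n → ℂ) : 0 ≤ euclNorm v := norm_nonneg _

theorem norm_star_dotProduct_le (x y : n → ℂ) :
    ‖star x ⬝ᵥ y‖ ≤ euclNorm x * euclNorm y := by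
  have h := norm_inner_le_norm (𝕜 := ℂ) (WithLp.toLp 2 x) (WithLp.toLp 2 y)
  rwa [EuclideanSpace.inner_eq_star_dotProduct, dotProduct_comm] at h

theorem star_dotProduct_self_eq (x : n → ℂ) : star x ⬝ᵥ x = ((euclNorm x ^ 2 : ℝ) : ℂ) := by
  have h := inner_self_eq_norm_sq_to_K (𝕜 := ℂ) (WithLp.toLp 2 x)
  rw [EuclideanSpace.inner_eq_star_dotProduct, dotProduct_comm] at h
  rw [h]; simp [euclNorm]

theorem euclNorm_star (x : n → ℂ) : euclNorm (star x) = euclNorm x := by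
  simp [euclNorm, EuclideanSpace.norm_eq]

theorem euclNorm_smul (t : ℝ) (x : n → ℂ) : euclNorm ((t : ℂ) • x) = |t| * euclNorm x := by
  simp [euclNorm, norm_smul]

theorem euclNorm_eq_of_conjTranspose_mul_self {P Q : Matrix n n ℂ} (h : Pᴴ * P = Qᴴ * Q)
    (x : n → ℂ) : euclNorm (P *ᵥ x) = euclNorm (Q *ᵥ x) := by
  have key : ∀ M : Matrix n n ℂ,
      ((euclNorm (M *ᵥ x) ^ 2 : ℝ) : ℂ) = star x ⬝ᵥ (Mᴴ * M) *ᵥ x := fun M => by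
    rw [← star_dotProduct_self_eq, star_mulVec, ← dotProduct_mulVec, mulVec_mulVec]
  have : euclNorm (P *ᵥ x) ^ 2 = euclNorm (Q *ᵥ x) ^ 2 := by
    exact_mod_cast (key P).trans ((congrArg (fun M => star x ⬝ᵥ M *ᵥ x) h).trans (key Q).symm)
  exact (sq_eq_sq₀ (euclNorm_nonneg _) (euclNorm_nonneg _)).1 this

variable [DecidableEq n]

theorem posDef_conjTranspose_mul_self_of_isUnit {P : Matrix n n ℂ} (hP : IsUnit P) :
    (Pᴴ * P).PosDef :=
  (posSemidef_conjTranspose_mul_self P).posDef_iff_isUnit.2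
    ((isUnit_conjTranspose (A := P)).2 hP |>.mul hP)

theorem Matrix.PosDef.exists_posDef_mul_self {a : Matrix n n ℂ} (ha : a.PosDef) :
    ∃ s : Matrix n n ℂ, s.PosDef ∧ s * s = a := by
  have hs : CFC.sqrt a * CFC.sqrt a = a := CFC.sqrt_mul_sqrt_self a ha.posSemidef.nonneg
  refine ⟨CFC.sqrt a, ?_, hs⟩
  refine (CFC.sqrt_nonneg a).posSemidef.posDef_iff_isUnit.2 ?_
  exact isUnit_of_mul_isUnit_left (hs ▸ ha.isUnit)

/-- The geometric mean of `a` and `(Qᴴ Q)⁻¹`. -/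
theorem exists_posDef_mul_mul_eq {a Q : Matrix n n ℂ} (ha : a.PosDef) (hQ : IsUnit Q) :
    ∃ m : Matrix n n ℂ, m.PosDef ∧ m * (Qᴴ * Q) * m = a := by
  have hQd : IsUnit Q.det := (isUnit_iff_isUnit_det Q).1 hQ
  have hQs : IsUnit Qᴴ := (isUnit_conjTranspose (A := Q)).2 hQ
  have hQsd : IsUnit Qᴴ.det := (isUnit_iff_isUnit_det _).1 hQs
  have h1 : (Q * a * Qᴴ).PosDef :=
    (ha.posSemidef.mul_mul_conjTranspose_same Q).posDef_iff_isUnit.2 ((hQ.mul ha.isUnit).mul hQs)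
  obtain ⟨s, hs, hss⟩ := h1.exists_posDef_mul_self
  -- The equation is equivalent to (Q m Qᴴ)² = Q a Qᴴ, which is solved by a square root.
  refine ⟨Q⁻¹ * s * (Q⁻¹)ᴴ, ?_, ?_⟩
  · refine (hs.posSemidef.mul_mul_conjTranspose_same Q⁻¹).posDef_iff_isUnit.2 ?_
    have hQi : IsUnit Q⁻¹ := (isUnit_nonsing_inv_iff).2 hQ
    exact (hQi.mul hs.isUnit).mul ((isUnit_conjTranspose (A := Q⁻¹)).2 hQi)
  · rw [conjTranspose_nonsing_inv]
    calc Q⁻¹ * s * (Qᴴ)⁻¹ * (Qᴴ * Q) * (Q⁻¹ * s * (Qᴴ)⁻¹)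
        = Q⁻¹ * s * ((Qᴴ)⁻¹ * Qᴴ) * (Q * Q⁻¹) * s * (Qᴴ)⁻¹ := by simp only [Matrix.mul_assoc]
      _ = Q⁻¹ * (s * s) * (Qᴴ)⁻¹ := by
        rw [nonsing_inv_mul _ hQsd, mul_nonsing_inv _ hQd]
        simp only [Matrix.mul_assoc, Matrix.mul_one]
      _ = (Q⁻¹ * Q) * a * (Qᴴ * (Qᴴ)⁻¹) := by rw [hss]; simp only [Matrix.mul_assoc]
      _ = a := by rw [nonsing_inv_mul _ hQd, mul_nonsing_inv _ hQsd]; simp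

/-- With s = √m₁, the columns of X are an orthonormal eigenbasis of s⁻¹ m₂ s⁻¹ transported by s⁻¹.
-/
theorem exists_simultaneous_diagonalization {m₁ m₂ : Matrix n n ℂ} (h₁ : m₁.PosDef)
    (h₂ : m₂.PosDef) : ∃ (X : Matrix n n ℂ) (μ : n → ℝ), (∀ k, 0 ≤ μ k) ∧
      Xᴴ * m₁ * X = 1 ∧ Xᴴ * m₂ * X = diagonal fun k => (μ k : ℂ) := by
  obtain ⟨s, hs, rfl⟩ := h₁.exists_posDef_mul_self
  have hsd : IsUnit s.det := (isUnit_iff_isUnit_det s).1 hs.isUnit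
  have hsi : (s⁻¹)ᴴ = s⁻¹ := by rw [conjTranspose_nonsing_inv, hs.isHermitian.eq]
  have hN : (s⁻¹ * m₂ * s⁻¹).PosSemidef := by
    have := h₂.posSemidef.mul_mul_conjTranspose_same s⁻¹
    rwa [hsi] at this
  set O : Matrix n n ℂ := (hN.1.eigenvectorUnitary : Matrix n n ℂ) with hO
  have hOO : Oᴴ * O = 1 := by
    have := Unitary.coe_star_mul_self hN.1.eigenvectorUnitary
    simpa [star_eq_conjTranspose] using this
  refine ⟨s⁻¹ * O, hN.1.eigenvalues, hN.eigenvalues_nonneg, ?_, ?_⟩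
  · calc (s⁻¹ * O)ᴴ * (s * s) * (s⁻¹ * O) = Oᴴ * (s⁻¹ * s) * (s * s⁻¹) * O := by
          rw [conjTranspose_mul, hsi]; simp only [Matrix.mul_assoc]
      _ = 1 := by rw [nonsing_inv_mul _ hsd, mul_nonsing_inv _ hsd]; simpa using hOO
  · calc (s⁻¹ * O)ᴴ * m₂ * (s⁻¹ * O) = Oᴴ * (s⁻¹ * m₂ * s⁻¹) * O := by
          rw [conjTranspose_mul, hsi]; simp only [Matrix.mul_assoc]
      _ = _ := by
        have h := hN.1.spectral_theorem
        rw [Unitary.conjStarAlgAut_apply] at h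
        have key : ∀ d : Matrix n n ℂ, Oᴴ * (O * d * Oᴴ) * O = d := fun d => by
          calc Oᴴ * (O * d * Oᴴ) * O = (Oᴴ * O) * d * (Oᴴ * O) := by simp only [Matrix.mul_assoc]
            _ = d := by rw [hOO]; simp
        exact (congrArg (fun M => Oᴴ * M * O) h).trans (key _)

end FiniteDimensional

/-! ### The trace inequality -/

section FiniteDimensional

open Matrix
open scoped ComplexOrder MatrixOrder

variable {n : Type*} [Fintype n]

theorem euclNorm_mulVec_eq_of_mul_mul_eq {m P Q : Matrix n n ℂ} (hm : m.IsHermitian)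
    (h : m * (Qᴴ * Q) * m = Pᴴ * P) (x : n → ℂ) :
    euclNorm (Q *ᵥ m *ᵥ x) = euclNorm (P *ᵥ x) := by
  rw [mulVec_mulVec]
  refine euclNorm_eq_of_conjTranspose_mul_self ?_ x
  rw [← h, conjTranspose_mul, hm.eq]
  simp only [Matrix.mul_assoc]

theorem star_dotProduct_conjTranspose_mul_mulVec (Q m : Matrix n n ℂ) (x y : n → ℂ) :
    star y ⬝ᵥ (Qᴴ * Q * m) *ᵥ x = star (Q *ᵥ y) ⬝ᵥ (Q *ᵥ m *ᵥ x) := by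
  rw [star_mulVec, ← dotProduct_mulVec, mulVec_mulVec, mulVec_mulVec]

theorem norm_star_dotProduct_mulVec_le_of_mul_mul_eq {m P Q : Matrix n n ℂ} (hm : m.IsHermitian)
    (h : m * (Qᴴ * Q) * m = Pᴴ * P) (x y : n → ℂ) :
    ‖star y ⬝ᵥ (Qᴴ * Q * m) *ᵥ x‖ ≤ euclNorm (P *ᵥ x) * euclNorm (Q *ᵥ y) := by
  rw [star_dotProduct_conjTranspose_mul_mulVec, mul_comm,
    ← euclNorm_mulVec_eq_of_mul_mul_eq hm h x]
  exact norm_star_dotProduct_le _ _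

/-- The equality case of Cauchy–Schwarz: Q m x = μ Q y with μ ≥ 0. -/
theorem star_dotProduct_mulVec_eq_of_mul_mul_eq {m P Q : Matrix n n ℂ} (hm : m.IsHermitian)
    (h : m * (Qᴴ * Q) * m = Pᴴ * P) {x y : n → ℂ} {μ : ℝ} (hμ : 0 ≤ μ)
    (hxy : m *ᵥ x = (μ : ℂ) • y) :
    star y ⬝ᵥ (Qᴴ * Q * m) *ᵥ x = ((euclNorm (P *ᵥ x) * euclNorm (Q *ᵥ y) : ℝ) : ℂ) := by
  rw [star_dotProduct_conjTranspose_mul_mulVec, ← euclNorm_mulVec_eq_of_mul_mul_eq hm h x, hxy,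
    mulVec_smul, dotProduct_smul, star_dotProduct_self_eq, euclNorm_smul, abs_of_nonneg hμ]
  simp; ring

variable [DecidableEq n]

/-- The columns xₖ of X and yₖ = m₁xₖ are dual bases, so tr V = ∑ yₖ* V xₖ. Since m₂xₖ = μₖyₖ as
well, the bound on each |yₖ* U xₖ| is exactly yₖ*(V₁ + V₂)xₖ. -/
theorem exists_re_trace_le {P Q R S : Matrix n n ℂ} (hP : IsUnit P) (hQ : IsUnit Q)
    (hR : IsUnit R) (hS : IsUnit S) {U : Matrix n n ℂ}
    (hU : ∀ x y : n → ℂ, ‖star y ⬝ᵥ U *ᵥ x‖ ≤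
      euclNorm (P *ᵥ x) * euclNorm (Q *ᵥ y) + euclNorm (R *ᵥ x) * euclNorm (S *ᵥ y)) :
    ∃ V₁ V₂ : Matrix n n ℂ,
      (∀ x y : n → ℂ, ‖star y ⬝ᵥ V₁ *ᵥ x‖ ≤ euclNorm (P *ᵥ x) * euclNorm (Q *ᵥ y)) ∧
      (∀ x y : n → ℂ, ‖star y ⬝ᵥ V₂ *ᵥ x‖ ≤ euclNorm (R *ᵥ x) * euclNorm (S *ᵥ y)) ∧
      U.trace.re ≤ (V₁ + V₂).trace.re := by
  obtain ⟨m₁, hm₁, h₁⟩ := exists_posDef_mul_mul_eq (posDef_conjTranspose_mul_self_of_isUnit hP) hQ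
  obtain ⟨m₂, hm₂, h₂⟩ := exists_posDef_mul_mul_eq (posDef_conjTranspose_mul_self_of_isUnit hR) hS
  obtain ⟨X, μ, hμ, hX₁, hX₂⟩ := exists_simultaneous_diagonalization hm₁ hm₂
  refine ⟨Qᴴ * Q * m₁, Sᴴ * S * m₂,
    norm_star_dotProduct_mulVec_le_of_mul_mul_eq hm₁.isHermitian h₁,
    norm_star_dotProduct_mulVec_le_of_mul_mul_eq hm₂.isHermitian h₂, ?_⟩
  set Y := m₁ * X with hY
  have hXY : Xᴴ * Y = 1 := by rw [hY, ← Matrix.mul_assoc, hX₁]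
  have hYX : Y * Xᴴ = 1 := mul_eq_one_comm.1 hXY
  have hXY' : X * Yᴴ = 1 := by
    have := congrArg conjTranspose hYX
    simpa using this
  have htr : ∀ V : Matrix n n ℂ, V.trace = ∑ k, star (Yᵀ k) ⬝ᵥ V *ᵥ (Xᵀ k) := fun V => by
    calc V.trace = (V * (X * Yᴴ)).trace := by rw [hXY', Matrix.mul_one]
      _ = (Yᴴ * V * X).trace := by
        rw [← Matrix.mul_assoc, Matrix.trace_mul_comm, Matrix.mul_assoc]
      _ = _ := by
        simp only [trace, diag_apply, mul_mul_apply]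
        rfl
  have hm₁X : ∀ k, m₁ *ᵥ (Xᵀ k) = ((1 : ℝ) : ℂ) • (Yᵀ k) := fun k => by
    ext i; simp [hY, mulVec, Matrix.mul_apply, dotProduct, mul_comm]
  have hm₂X : ∀ k, m₂ *ᵥ (Xᵀ k) = (μ k : ℂ) • (Yᵀ k) := fun k => by
    have : m₂ * X = Y * diagonal fun k => (μ k : ℂ) := by
      rw [← hX₂, ← Matrix.mul_assoc, ← Matrix.mul_assoc, hYX, Matrix.one_mul]
    ext i
    have := congrFun (congrFun this i) k
    rw [mul_diagonal, Matrix.mul_apply] at this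
    simpa [mulVec, dotProduct, mul_comm] using this
  rw [htr, htr, Complex.re_sum, Complex.re_sum]
  refine Finset.sum_le_sum fun k _ => ?_
  rw [add_mulVec, dotProduct_add,
    star_dotProduct_mulVec_eq_of_mul_mul_eq hm₁.isHermitian h₁ zero_le_one (hm₁X k),
    star_dotProduct_mulVec_eq_of_mul_mul_eq hm₂.isHermitian h₂ (hμ k) (hm₂X k),
    ← Complex.ofReal_add, Complex.ofReal_re]
  exact (Complex.re_le_norm _).trans (hU _ _)

/-- Since y* T U x = (T*y)* U x, this is the case T = 1 for TU, with QT* and ST* in place of Q and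
S. -/
theorem exists_re_trace_mul_le {P Q R S T : Matrix n n ℂ} (hP : IsUnit P) (hQ : IsUnit Q)
    (hR : IsUnit R) (hS : IsUnit S) (hT : IsUnit T) {U : Matrix n n ℂ}
    (hU : ∀ x y : n → ℂ, ‖star y ⬝ᵥ U *ᵥ x‖ ≤
      euclNorm (P *ᵥ x) * euclNorm (Q *ᵥ y) + euclNorm (R *ᵥ x) * euclNorm (S *ᵥ y)) :
    ∃ V₁ V₂ : Matrix n n ℂ,
      (∀ x y : n → ℂ, ‖star y ⬝ᵥ V₁ *ᵥ x‖ ≤ euclNorm (P *ᵥ x) * euclNorm (Q *ᵥ y)) ∧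
      (∀ x y : n → ℂ, ‖star y ⬝ᵥ V₂ *ᵥ x‖ ≤ euclNorm (R *ᵥ x) * euclNorm (S *ᵥ y)) ∧
      (T * U).trace.re ≤ (T * (V₁ + V₂)).trace.re := by
  have hTs : IsUnit Tᴴ := (isUnit_conjTranspose (A := T)).2 hT
  have hTd := (isUnit_iff_isUnit_det T).1 hT
  have hTsd := (isUnit_iff_isUnit_det Tᴴ).1 hTs
  have hmul : ∀ (V : Matrix n n ℂ) (x y : n → ℂ),
      star y ⬝ᵥ (T * V) *ᵥ x = star (Tᴴ *ᵥ y) ⬝ᵥ V *ᵥ x := fun V x y => by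
    rw [star_mulVec, conjTranspose_conjTranspose, ← dotProduct_mulVec, mulVec_mulVec]
  obtain ⟨W₁, W₂, h₁, h₂, h⟩ := exists_re_trace_le hP (hQ.mul hTs) hR (hS.mul hTs) (U := T * U)
    fun x y => by simpa only [hmul, mulVec_mulVec] using hU x (Tᴴ *ᵥ y)
  have key : ∀ {L M W : Matrix n n ℂ},
      (∀ x y : n → ℂ, ‖star y ⬝ᵥ W *ᵥ x‖ ≤ euclNorm (L *ᵥ x) * euclNorm ((M * Tᴴ) *ᵥ y)) →
      ∀ x y : n → ℂ, ‖star y ⬝ᵥ (T⁻¹ * W) *ᵥ x‖ ≤ euclNorm (L *ᵥ x) * euclNorm (M *ᵥ y) := by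
    intro L M W hW x y
    have := hW x ((Tᴴ)⁻¹ *ᵥ y)
    rwa [mulVec_mulVec, Matrix.mul_assoc, mul_nonsing_inv _ hTsd, Matrix.mul_one, star_mulVec,
      conjTranspose_nonsing_inv, conjTranspose_conjTranspose, ← dotProduct_mulVec,
      mulVec_mulVec] at this
  refine ⟨T⁻¹ * W₁, T⁻¹ * W₂, key h₁, key h₂, ?_⟩
  rwa [← Matrix.mul_add, ← Matrix.mul_assoc, mul_nonsing_inv _ hTd, Matrix.one_mul]

end FiniteDimensional

/-! ### Hahn–Banach separation for matrices -/

section FiniteDimensional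

open Matrix
open scoped Matrix.Norms.Elementwise Pointwise

variable {n : Type*} [Fintype n]

/-- The matrices whose sesquilinear form is dominated by `‖P x‖ ‖Q y‖`. -/
def dominatedMatrices (P Q : Matrix n n ℂ) : Set (Matrix n n ℂ) :=
  {V | ∀ x y : n → ℂ, ‖star y ⬝ᵥ V *ᵥ x‖ ≤ euclNorm (P *ᵥ x) * euclNorm (Q *ᵥ y)}

theorem convex_dominatedMatrices (P Q : Matrix n n ℂ) : Convex ℝ (dominatedMatrices P Q) := by
  intro V hV W hW a b ha hb hab x y
  rw [add_mulVec, smul_mulVec, smul_mulVec, dotProduct_add, dotProduct_smul, dotProduct_smul]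
  refine (norm_add_le _ _).trans ?_
  rw [norm_smul, norm_smul, Real.norm_of_nonneg ha, Real.norm_of_nonneg hb]
  have h1 := mul_le_mul_of_nonneg_left (hV x y) ha
  have h2 := mul_le_mul_of_nonneg_left (hW x y) hb
  refine (add_le_add h1 h2).trans_eq ?_
  rw [← add_mul, hab, one_mul]

theorem isCompact_dominatedMatrices (P Q : Matrix n n ℂ) : IsCompact (dominatedMatrices P Q) := by
  classical
  refine Metric.isCompact_of_isClosed_isBounded ?_ ?_
  · simp only [dominatedMatrices, Set.ofPred_forall]
    refine isClosed_iInter fun x => isClosed_iInter fun y => isClosed_le ?_ continuous_const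
    fun_prop
  · rw [isBounded_iff_forall_norm_le]
    refine ⟨∑ i, ∑ j, euclNorm (P *ᵥ Pi.single j 1) * euclNorm (Q *ᵥ Pi.single i 1),
      fun V hV => ?_⟩
    have hnn : ∀ i j, 0 ≤ euclNorm (P *ᵥ Pi.single j 1) * euclNorm (Q *ᵥ Pi.single i 1) :=
      fun i j => mul_nonneg (euclNorm_nonneg _) (euclNorm_nonneg _)
    rw [Matrix.norm_le_iff (Finset.sum_nonneg fun i _ => Finset.sum_nonneg fun j _ => hnn i j)]
    intro i j
    have h := hV (Pi.single j 1) (Pi.single i 1)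
    rw [← Pi.single_star, star_one, mulVec_single_one, single_one_dotProduct] at h
    refine h.trans ?_
    refine (Finset.single_le_sum (f := fun j => euclNorm (P *ᵥ Pi.single j 1) *
      euclNorm (Q *ᵥ Pi.single i 1)) (fun j _ => hnn i j) (Finset.mem_univ j)).trans ?_
    exact Finset.single_le_sum (f := fun i => ∑ j, euclNorm (P *ᵥ Pi.single j 1) *
      euclNorm (Q *ᵥ Pi.single i 1)) (fun i _ => Finset.sum_nonneg fun j _ => hnn i j)
      (Finset.mem_univ i)

variable [DecidableEq n]

theorem exists_eq_trace_mul (f : Matrix n n ℂ →ₗ[ℂ] ℂ) :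
    ∃ T : Matrix n n ℂ, ∀ V, f V = (T * V).trace := by
  refine ⟨of fun i j => f (Matrix.single j i 1), fun V => ?_⟩
  conv_lhs => rw [matrix_eq_sum_single V]
  rw [trace_mul_comm]
  simp only [map_sum, trace, diag_apply, Matrix.mul_apply, of_apply]
  refine Finset.sum_congr rfl fun i _ => Finset.sum_congr rfl fun j _ => ?_
  rw [← smul_eq_mul (V i j), ← map_smul, smul_single, smul_eq_mul, mul_one]

theorem exists_pos_lt_isUnit_add_smul_one (T : Matrix n n ℂ) {η : ℝ} (hη : 0 < η) :
    ∃ δ : ℝ, 0 < δ ∧ δ < η ∧ IsUnit (T + (δ : ℂ) • (1 : Matrix n n ℂ)) := by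
  have hfin : (spectrum ℂ (-T)).Finite := Matrix.finite_spectrum _
  have hinj : Function.Injective ((↑) : ℝ → ℂ) := Complex.ofReal_injective
  obtain ⟨δ, hδ, hδ'⟩ := ((Set.Ioo_infinite hη).sdiff (hfin.preimage hinj.injOn)).nonempty
  refine ⟨δ, hδ.1, hδ.2, ?_⟩
  have := spectrum.notMem_iff.1 hδ'
  rwa [sub_neg_eq_add, add_comm, Algebra.algebraMap_eq_smul_one] at this

/-- Splitting a sesquilinear form on a finite-dimensional space. -/
theorem mem_dominatedMatrices_add {P Q R S : Matrix n n ℂ} (hP : IsUnit P) (hQ : IsUnit Q)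
    (hR : IsUnit R) (hS : IsUnit S) {U : Matrix n n ℂ}
    (hU : ∀ x y : n → ℂ, ‖star y ⬝ᵥ U *ᵥ x‖ ≤
      euclNorm (P *ᵥ x) * euclNorm (Q *ᵥ y) + euclNorm (R *ᵥ x) * euclNorm (S *ᵥ y)) :
    U ∈ dominatedMatrices P Q + dominatedMatrices R S := by
  by_contra hnot
  have hcomp : IsCompact (dominatedMatrices P Q + dominatedMatrices R S) :=
    (isCompact_dominatedMatrices P Q).add (isCompact_dominatedMatrices R S)
  have : LocallyConvexSpace ℝ (Matrix n n ℂ) :=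
    inferInstanceAs (LocallyConvexSpace ℝ (n → n → ℂ))
  obtain ⟨f, s, hf, hs⟩ := RCLike.geometric_hahn_banach_closed_point (𝕜 := ℂ)
    ((convex_dominatedMatrices P Q).add (convex_dominatedMatrices R S)) hcomp.isClosed hnot
  obtain ⟨T, hT⟩ := exists_eq_trace_mul (f : Matrix n n ℂ →ₗ[ℂ] ℂ)
  replace hT : ∀ V, f V = (T * V).trace := hT
  obtain ⟨c, hc⟩ := hcomp.exists_bound_of_continuousOn (f := fun V => (V - U).trace)
    (by fun_prop)
  have hgap : 0 < RCLike.re (f U) - s := sub_pos.2 hs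
  -- Replacing T by T + δ changes the comparison of U with V by δ Re tr(V - U) ≤ δ|c|, too little to
  -- close the separation gap.
  obtain ⟨δ, hδ, hδη, hTδ⟩ := exists_pos_lt_isUnit_add_smul_one T
    (div_pos hgap (by positivity : 0 < |c| + 1))
  obtain ⟨V₁, V₂, h₁, h₂, h⟩ := exists_re_trace_mul_le hP hQ hR hS hTδ hU
  have hmem : V₁ + V₂ ∈ dominatedMatrices P Q + dominatedMatrices R S := Set.add_mem_add h₁ h₂
  have hlt := hf _ hmem
  have hb := (Complex.re_le_norm _).trans (hc _ hmem)
  rw [lt_div_iff₀ (by positivity)] at hδη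
  simp only [hT, RCLike.re_to_complex] at hlt hδη
  simp only [Matrix.add_mul, Matrix.smul_mul, Matrix.one_mul, trace_add, trace_smul,
    Complex.add_re, smul_eq_mul, Complex.re_ofReal_mul, trace_sub, Complex.sub_re,
    Matrix.mul_add] at h hlt hb hδη
  have h3 := mul_le_mul_of_nonneg_left (hb.trans (le_abs_self c)) hδ.le
  nlinarith

end FiniteDimensional

/-! ### Pullback to ℂⁿ and regularization -/

section Regularization

open Matrix
open scoped ComplexOrder MatrixOrder

variable {n : Type*} [Fintype n] [DecidableEq n]
  {H K : Type*} [NormedAddCommGroup H] [InnerProductSpace ℂ H]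
  [NormedAddCommGroup K] [InnerProductSpace ℂ K]

/-- P is the square root of the Gram matrix of p plus ε; the ε makes it invertible even if p is not
injective. -/
theorem exists_isUnit_euclNorm_mulVec (p : (n → ℂ) →ₗ[ℂ] H) {ε : ℝ} (hε : 0 < ε) :
    ∃ P : Matrix n n ℂ, IsUnit P ∧
      ∀ x, euclNorm (P *ᵥ x) = √(‖p x‖ ^ 2 + ε * euclNorm x ^ 2) := by
  set v : n → H := fun i => p (Pi.single i 1) with hv
  have hpd : (gram ℂ v + (ε : ℂ) • (1 : Matrix n n ℂ)).PosDef :=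
    (PosDef.one.smul (by exact_mod_cast hε)).posSemidef_add (posSemidef_gram ℂ v)
  obtain ⟨s, hs, hss⟩ := hpd.exists_posDef_mul_self
  refine ⟨s, hs.isUnit, fun x => ?_⟩
  have hpx : ∑ i, x i • v i = p x := by
    rw [LinearMap.pi_apply_eq_sum_univ p x]
    refine Finset.sum_congr rfl fun i _ => ?_
    refine congrArg (x i • p ·) (funext fun j => ?_)
    simp [Pi.single_apply, eq_comm]
  have h : ((euclNorm (s *ᵥ x) ^ 2 : ℝ) : ℂ) = ((‖p x‖ ^ 2 + ε * euclNorm x ^ 2 : ℝ) : ℂ) := by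
    rw [← star_dotProduct_self_eq, star_mulVec, ← dotProduct_mulVec, mulVec_mulVec,
      hs.isHermitian.eq, hss, add_mulVec, dotProduct_add, star_dotProduct_gram_mulVec, hpx,
      inner_self_eq_norm_sq_to_K, smul_mulVec, one_mulVec, dotProduct_smul,
      star_dotProduct_self_eq]
    simp
  rw [← Complex.ofReal_injective h, Real.sqrt_sq (euclNorm_nonneg _)]

/-- Splitting of a pulled back bilinear form, with strictly positive regularised bounds. -/
theorem exists_regularized_splitting {A C : H →ₗ[ℂ] H} {B D : K →ₗ[ℂ] K}
    {u : H →ₗ[ℂ] K →ₗ[ℂ] ℂ}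
    (hu : ∀ (x : H) (y : K), ‖u x y‖ ≤ ‖A x‖ * ‖B y‖ + ‖C x‖ * ‖D y‖)
    (p : (n → ℂ) →ₗ[ℂ] H) (q : (n → ℂ) →ₗ[ℂ] K) {ε : ℝ} (hε : 0 < ε) :
    ∃ V : (n → ℂ) →ₗ[ℂ] (n → ℂ) →ₗ[ℂ] ℂ,
      (∀ x y, ‖V x y‖ ≤ √(‖A (p x)‖ ^ 2 + ε * euclNorm x ^ 2) *
        √(‖B (q y)‖ ^ 2 + ε * euclNorm y ^ 2)) ∧
      (∀ x y, ‖u (p x) (q y) - V x y‖ ≤ √(‖C (p x)‖ ^ 2 + ε * euclNorm x ^ 2) *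
        √(‖D (q y)‖ ^ 2 + ε * euclNorm y ^ 2)) := by
  -- The matrix result is sesquilinear while u is bilinear, so y is conjugated and Q replaced by its
  -- entrywise conjugate.
  have hconj : ∀ r : (n → ℂ) →ₗ[ℂ] K, ∃ Q : Matrix n n ℂ, IsUnit Q ∧
      ∀ y, euclNorm (Q *ᵥ star y) = √(‖r y‖ ^ 2 + ε * euclNorm y ^ 2) := fun r => by
    obtain ⟨Q, hQ, h⟩ := exists_isUnit_euclNorm_mulVec r hε
    refine ⟨(Qᴴ)ᵀ, (isUnit_transpose _).2 ((isUnit_conjTranspose (A := Q)).2 hQ), fun y => ?_⟩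
    rw [← h, ← euclNorm_star (Q *ᵥ y), star_mulVec, mulVec_transpose]
  obtain ⟨P, hP, hPx⟩ := exists_isUnit_euclNorm_mulVec (A ∘ₗ p) hε
  obtain ⟨R, hR, hRx⟩ := exists_isUnit_euclNorm_mulVec (C ∘ₗ p) hε
  obtain ⟨Q, hQ, hQy⟩ := hconj (B ∘ₗ q)
  obtain ⟨S, hS, hSy⟩ := hconj (D ∘ₗ q)
  have hle : ∀ (a : ℝ) (x : n → ℂ), 0 ≤ a → a ≤ √(a ^ 2 + ε * euclNorm x ^ 2) := fun a x ha =>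
    Real.le_sqrt_of_sq_le (by nlinarith [mul_nonneg hε.le (sq_nonneg (euclNorm x))])
  set U : Matrix n n ℂ := LinearMap.toMatrix₂' ℂ (u.compl₁₂ p q).flip with hUdef
  have hU : ∀ x y, y ⬝ᵥ U *ᵥ x = u (p x) (q y) := fun x y => by
    rw [← Matrix.toLinearMap₂'_apply', hUdef, Matrix.toLinearMap₂'_toMatrix']
    rfl
  obtain ⟨V, hV, W, hW, hVW⟩ := Set.mem_add.1 <|
    mem_dominatedMatrices_add hP hQ hR hS (U := U) fun x y => by
      have hQ' := hQy (star y)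
      have hS' := hSy (star y)
      rw [star_star] at hQ' hS'
      rw [hU, hPx, hRx, hQ', hS']
      refine (hu _ _).trans (add_le_add ?_ ?_) <;>
      exact mul_le_mul (hle _ _ (norm_nonneg _)) (hle _ _ (norm_nonneg _)) (norm_nonneg _)
        (Real.sqrt_nonneg _)
  refine ⟨(Matrix.toLinearMap₂' ℂ V).flip, fun x y => ?_, fun x y => ?_⟩
  · have := hV x (star y)
    rw [star_star, hPx, hQy] at this
    rwa [LinearMap.flip_apply, Matrix.toLinearMap₂'_apply']
  · have := hW x (star y)
    rw [star_star, hRx, hSy] at this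
    rwa [LinearMap.flip_apply, Matrix.toLinearMap₂'_apply', ← hU, ← hVW, add_mulVec,
      dotProduct_add, add_sub_cancel_left]

end Regularization

/-! ### Finite-dimensional subspaces and ultrafilter limits -/

section Limit

open Filter Topology

variable {H K : Type*} [NormedAddCommGroup H] [InnerProductSpace ℂ H]
  [NormedAddCommGroup K] [InnerProductSpace ℂ K]

theorem euclNorm_inner_eq_norm {ι : Type*} [Fintype ι] {v : ι → H} {x : H}
    (h : ∑ i, inner ℂ (v i) x • v i = x) : euclNorm (fun i => inner ℂ (v i) x) = ‖x‖ := by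
  have h1 : ((euclNorm (fun i => inner ℂ (v i) x) ^ 2 : ℝ) : ℂ) = ((‖x‖ ^ 2 : ℝ) : ℂ) := by
    have h2 : inner ℂ x x = ((‖x‖ ^ 2 : ℝ) : ℂ) := by
      rw [inner_self_eq_norm_sq_to_K]; simp
    rw [← star_dotProduct_self_eq, ← h2]
    conv_rhs => rw [← h]
    conv_rhs => enter [3]; rw [h]
    rw [sum_inner]
    simp only [dotProduct, inner_smul_left]
    rfl
  exact (sq_eq_sq₀ (euclNorm_nonneg _) (norm_nonneg _)).1 (Complex.ofReal_injective h1)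

theorem exists_local_splitting {A C : H →ₗ[ℂ] H} {B D : K →ₗ[ℂ] K}
    {u : H →ₗ[ℂ] K →ₗ[ℂ] ℂ}
    (hu : ∀ (x : H) (y : K), ‖u x y‖ ≤ ‖A x‖ * ‖B y‖ + ‖C x‖ * ‖D y‖)
    (E : Submodule ℂ H) (F : Submodule ℂ K) [FiniteDimensional ℂ E] [FiniteDimensional ℂ F]
    {ε : ℝ} (hε : 0 < ε) :
    ∃ w : H →ₗ[ℂ] K →ₗ[ℂ] ℂ, ∀ x ∈ E, ∀ y ∈ F,
      ‖w x y‖ ≤ √(‖A x‖ ^ 2 + ε * ‖x‖ ^ 2) * √(‖B y‖ ^ 2 + ε * ‖y‖ ^ 2) ∧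
      ‖u x y - w x y‖ ≤ √(‖C x‖ ^ 2 + ε * ‖x‖ ^ 2) * √(‖D y‖ ^ 2 + ε * ‖y‖ ^ 2) := by
  set e := stdOrthonormalBasis ℂ E
  set f := stdOrthonormalBasis ℂ F
  -- Both bases are padded with zeros to a common index type, so that all matrices are square of one
  -- size.
  let v : Fin (Module.finrank ℂ E) ⊕ Fin (Module.finrank ℂ F) → H := Sum.elim (fun i => (e i : H)) 0
  let v' : Fin (Module.finrank ℂ E) ⊕ Fin (Module.finrank ℂ F) → K := Sum.elim 0 (fun i => (f i : K))
  have hv : ∀ x ∈ E, ∑ i, inner ℂ (v i) x • v i = x := fun x hx => by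
    have := congrArg Subtype.val (e.sum_repr' ⟨x, hx⟩)
    simpa [v, Fintype.sum_sum_type] using this
  have hv' : ∀ y ∈ F, ∑ i, inner ℂ (v' i) y • v' i = y := fun y hy => by
    have := congrArg Subtype.val (f.sum_repr' ⟨y, hy⟩)
    simpa [v', Fintype.sum_sum_type] using this
  obtain ⟨V, h₁, h₂⟩ := exists_regularized_splitting hu (Fintype.linearCombination ℂ v)
    (Fintype.linearCombination ℂ v') hε
  refine ⟨V.compl₁₂ (LinearMap.pi fun i => innerₛₗ ℂ (v i))
    (LinearMap.pi fun i => innerₛₗ ℂ (v' i)), fun x hx y hy => ?_⟩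
  have g₁ := h₁ (fun i => inner ℂ (v i) x) (fun i => inner ℂ (v' i) y)
  have g₂ := h₂ (fun i => inner ℂ (v i) x) (fun i => inner ℂ (v' i) y)
  rw [Fintype.linearCombination_apply, Fintype.linearCombination_apply, hv x hx, hv' y hy,
    euclNorm_inner_eq_norm (hv x hx), euclNorm_inner_eq_norm (hv' y hy)] at g₁ g₂
  exact ⟨g₁, g₂⟩

/-- Closed balls of ℂ are compact, so the values converge along the ultrafilter; uniqueness of
limits preserves bilinearity. -/
theorem exists_tendsto_of_eventually_bounded {I : Type*} (l : Ultrafilter I)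
    (w : I → H →ₗ[ℂ] K →ₗ[ℂ] ℂ) (hw : ∀ x y, ∃ M, ∀ᶠ i in (l : Filter I), ‖w i x y‖ ≤ M) :
    ∃ w₀ : H →ₗ[ℂ] K →ₗ[ℂ] ℂ, ∀ x y, Tendsto (fun i => w i x y) l (𝓝 (w₀ x y)) := by
  have hlim : ∀ x y, ∃ z, Tendsto (fun i => w i x y) l (𝓝 z) := fun x y => by
    obtain ⟨M, hM⟩ := hw x y
    obtain ⟨z, -, hz⟩ := (isCompact_closedBall (0 : ℂ) M).ultrafilter_le_nhds'
      (l.map fun i => w i x y) (Ultrafilter.mem_map.2 (mem_of_superset hM fun i h => by simpa using h))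
    exact ⟨z, hz⟩
  choose g hg using hlim
  refine ⟨LinearMap.mk₂ ℂ g (fun x x' y => ?_) (fun c x y => ?_) (fun x y y' => ?_)
    (fun c x y => ?_), hg⟩
  · exact tendsto_nhds_unique (by simpa using hg (x + x') y) ((hg x y).add (hg x' y))
  · exact tendsto_nhds_unique (by simpa using hg (c • x) y) ((hg x y).const_mul c)
  · exact tendsto_nhds_unique (by simpa using hg x (y + y')) ((hg x y).add (hg x y'))
  · exact tendsto_nhds_unique (by simpa using hg x (c • y)) ((hg x y).const_mul c)

end Limit

/-! ### The theorem on Hilbert spaces -/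

open Filter Topology in
theorem mainTheorem3 {H K : Type*}
    [NormedAddCommGroup H] [InnerProductSpace ℂ H] [CompleteSpace H]
    [NormedAddCommGroup K] [InnerProductSpace ℂ K] [CompleteSpace K]
    (A C : H →L[ℂ] H) (B D : K →L[ℂ] K) (u : H →ₗ[ℂ] K →ₗ[ℂ] ℂ)
    (hu : ∀ (x : H) (y : K), ‖u x y‖ ≤ ‖A x‖ * ‖B y‖ + ‖C x‖ * ‖D y‖) :
    ∃ u₁ u₂ : H →ₗ[ℂ] K →ₗ[ℂ] ℂ,
      u = u₁ + u₂ ∧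
      (∀ (x : H) (y : K), ‖u₁ x y‖ ≤ ‖A x‖ * ‖B y‖) ∧
      (∀ (x : H) (y : K), ‖u₂ x y‖ ≤ ‖C x‖ * ‖D y‖) := by
  classical
  -- Along this directed index set the spans eventually contain any given x and y, while ε tends to
  -- 0.
  let ε : Finset H × Finset K × ℕ → ℝ := fun i => 1 / ((i.2.2 : ℝ) + 1)
  have hε : ∀ i, 0 < ε i := fun i => Nat.one_div_pos_of_nat
  choose w hw using fun i : Finset H × Finset K × ℕ =>
    exists_local_splitting (A := (A : H →ₗ[ℂ] H)) (C := (C : H →ₗ[ℂ] H)) (B := (B : K →ₗ[ℂ] K))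
      (D := (D : K →ₗ[ℂ] K)) hu (Submodule.span ℂ (i.1 : Set H))
      (Submodule.span ℂ (i.2.1 : Set K)) (hε i)
  let l : Ultrafilter (Finset H × Finset K × ℕ) := Ultrafilter.of atTop
  have hl : (l : Filter (Finset H × Finset K × ℕ)) ≤ atTop := Ultrafilter.of_le atTop
  have hε0 : Tendsto ε l (𝓝 0) := by
    refine Tendsto.mono_left ?_ hl
    exact tendsto_one_div_add_atTop_nhds_zero_nat.comp
      (tendsto_atTop_mono' _ (Eventually.of_forall fun i => le_rfl)
        (tendsto_atTop_atTop.2 fun N => ⟨(∅, ∅, N), fun i hi => hi.2.2⟩))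
  have hev : ∀ x y, ∀ᶠ i in (l : Filter (Finset H × Finset K × ℕ)),
      ‖w i x y‖ ≤ √(‖A x‖ ^ 2 + ε i * ‖x‖ ^ 2) * √(‖B y‖ ^ 2 + ε i * ‖y‖ ^ 2) ∧
      ‖u x y - w i x y‖ ≤ √(‖C x‖ ^ 2 + ε i * ‖x‖ ^ 2) * √(‖D y‖ ^ 2 + ε i * ‖y‖ ^ 2) :=
    fun x y => hl <| (eventually_ge_atTop (({x}, {y}, 0) : Finset H × Finset K × ℕ)).mono
      fun i hi => hw i x (Submodule.subset_span (hi.1 (Finset.mem_singleton_self x)))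
        y (Submodule.subset_span (hi.2.1 (Finset.mem_singleton_self y)))
  have hbound : ∀ a b c d : ℝ, 0 ≤ a → 0 ≤ b →
      Tendsto (fun i => √(a ^ 2 + ε i * c ^ 2) * √(b ^ 2 + ε i * d ^ 2)) l (𝓝 (a * b)) :=
    fun a b c d ha hb => by
      have h : ∀ a c : ℝ, 0 ≤ a → Tendsto (fun i => √(a ^ 2 + ε i * c ^ 2)) l (𝓝 a) :=
        fun a c ha => by
          have := ((hε0.mul_const (c ^ 2)).const_add (a ^ 2)).sqrt
          rwa [zero_mul, add_zero, Real.sqrt_sq ha] at this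
      exact (h a c ha).mul (h b d hb)
  obtain ⟨u₁, hu₁⟩ := exists_tendsto_of_eventually_bounded l w fun x y => by
    have h := hbound ‖A x‖ ‖B y‖ ‖x‖ ‖y‖ (norm_nonneg _) (norm_nonneg _)
    refine ⟨‖A x‖ * ‖B y‖ + 1, ?_⟩
    filter_upwards [hev x y, h.eventually_le_const (lt_add_one _)] with i h₁ h₂
    exact h₁.1.trans h₂
  refine ⟨u₁, u - u₁, (add_sub_cancel u₁ u).symm, fun x y => ?_, fun x y => ?_⟩
  · exact le_of_tendsto_of_tendsto (hu₁ x y).norm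
      (hbound _ _ ‖x‖ ‖y‖ (norm_nonneg _) (norm_nonneg _)) ((hev x y).mono fun i h => h.1)
  · exact le_of_tendsto_of_tendsto ((hu₁ x y).const_sub (u x y)).norm
      (hbound _ _ ‖x‖ ‖y‖ (norm_nonneg _) (norm_nonneg _)) ((hev x y).mono fun i h => h.2)
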